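/- Let $G$ be a compact, connected Lie group endowed with a bi-invariant Riemannian metric $Q$, let $\mathfrak g=T_eG$ be its Lie algebra, and denote by $Q$ also the induced scalar product on $\mathfrak g$. Then there exists a constant $C=C(G,Q)>0$ with the following property. Let $I\subset\{1,\dots,\dim\mathfrak g\}$ with $1\in I$, let $I^{\rm c}=\{1,\dots,\dim\mathfrak g\}\setminus I$, and let $Z_I$ denote the set of all ordered $Q$-orthonormal bases $(e_1,\dots,e_{\dim\mathfrak g})$ of $\mathfrak g$ such that $\mathfrak t:=\bigoplus_{i\in I}\langle e_i\rangle$ is an abelian subalgebra of $\mathfrak g$. Then there exists an open neighborhood $U_I$ of $Z_I$ in the space of all ordered $Q$-orthonormal bases of $\mathfrak g$ such that for all $(\tilde e_1,\dots,\tilde e_{\dim\mathfrak g})\in U_I$ we have $$\sum_{j,k\in I}Q([\tilde e_1,\tilde e_j],\tilde e_k)^2\;\le\; C\cdot\sum_{j\in I,\;k\in I^{\rm c}}Q([\tilde e_1,\tilde e_j],\tilde e_k)^2 .$$ -/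

import Mathlib

open Module Bundle
open scoped Manifold ContDiff

/-- For real Lie groups, a smooth (`C^∞`) Lie group is regular enough (`C^3`) for its tangent space
at the identity to be a Lie algebra. -/
instance instLEInftyMinSmoothnessReal : ENat.LEInfty (minSmoothness ℝ 3) where
  out := by
    rw [minSmoothness_of_isRCLikeNormedField]
    exact ENat.LEInfty.out

namespace LieGroupMetric

section

variable {E : Type*} [NormedAddCommGroup E] [NormedSpace ℝ E]
  {G : Type*} [TopologicalSpace G] [ChartedSpace E G] [Group G] [LieGroup 𝓘(ℝ, E) ∞ G]

/-- A smooth Riemannian metric on a Lie group is bi-invariant if all left translations and all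
right translations are isometries. -/
def IsBiInvariant
    (Q : ContMDiffRiemannianMetric 𝓘(ℝ, E) ∞ E (TangentSpace 𝓘(ℝ, E) : G → Type _)) : Prop :=
  (∀ (g x : G) (v w : TangentSpace 𝓘(ℝ, E) x),
    Q.inner (g * x) (mfderiv 𝓘(ℝ, E) 𝓘(ℝ, E) (fun y : G => g * y) x v)
      (mfderiv 𝓘(ℝ, E) 𝓘(ℝ, E) (fun y : G => g * y) x w) = Q.inner x v w) ∧
  (∀ (g x : G) (v w : TangentSpace 𝓘(ℝ, E) x),
    Q.inner (x * g) (mfderiv 𝓘(ℝ, E) 𝓘(ℝ, E) (fun y : G => y * g) x v)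
      (mfderiv 𝓘(ℝ, E) 𝓘(ℝ, E) (fun y : G => y * g) x w) = Q.inner x v w)

/-- The set of all ordered `Q`-orthonormal bases `(e_i)` of the Lie algebra `𝔤 = T_1 G`, the index
set `{1, …, dim 𝔤}` being represented by `Fin (dim 𝔤)`; it is a subset of the finite
power of `𝔤`, from which it gets its topology. -/
def orthonormalBases
    (Q : ContMDiffRiemannianMetric 𝓘(ℝ, E) ∞ E (TangentSpace 𝓘(ℝ, E) : G → Type _)) :
    Set (Fin (finrank ℝ (GroupLieAlgebra 𝓘(ℝ, E) G)) → GroupLieAlgebra 𝓘(ℝ, E) G) :=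
  {e | (∃ B : Basis (Fin (finrank ℝ (GroupLieAlgebra 𝓘(ℝ, E) G))) ℝ (GroupLieAlgebra 𝓘(ℝ, E) G),
      ⇑B = e) ∧ ∀ i j, Q.inner 1 (e i) (e j) = if i = j then 1 else 0}

/-- The set of all `Q`-orthonormal bases `(e_i)` of `𝔤` such that the span of the `e_i` with
`i ∈ I` is an abelian Lie subalgebra, as a subset of the space of all orthonormal bases. -/
def abelianBases [FiniteDimensional ℝ E]
    (Q : ContMDiffRiemannianMetric 𝓘(ℝ, E) ∞ E (TangentSpace 𝓘(ℝ, E) : G → Type _))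
    (I : Finset (Fin (finrank ℝ (GroupLieAlgebra 𝓘(ℝ, E) G)))) :
    Set (orthonormalBases Q) :=
  haveI : CompleteSpace E := FiniteDimensional.complete ℝ E
  {b | ∃ 𝔱 : LieSubalgebra ℝ (GroupLieAlgebra 𝓘(ℝ, E) G),
      𝔱.toSubmodule = Submodule.span ℝ (b.1 '' (I : Set _)) ∧ IsLieAbelian 𝔱}

/-- The square `Q([e_i, e_j], e_k)²` of the structure constant of the tuple `e`. -/
noncomputable def structureConstSq
    (Q : ContMDiffRiemannianMetric 𝓘(ℝ, E) ∞ E (TangentSpace 𝓘(ℝ, E) : G → Type _))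
    {n : ℕ} (e : Fin n → GroupLieAlgebra 𝓘(ℝ, E) G) (i j k : Fin n) : ℝ :=
  (Q.inner 1 ⁅e i, e j⁆ (e k)) ^ 2

end

end LieGroupMetric

/-! The bi-invariance of `Q` makes every `ad x` skew, and the rest is linear algebra on `𝔤 ⊗ ℂ` with
conjugation `σ`, where the adjoint of `ad w` is `-ad (σ w)`.

If `[w, σ w] = 0`, the Jacobi identity makes `ad w` normal. If `ad w` is also nilpotent it vanishes,
so `w` is central. By compactness `‖[w, σ w]‖ ≥ c ‖w‖²` for all `w` orthogonal to the centre with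
`ad w` nilpotent. The bound survives, with a smaller constant, for approximate eigenvectors `w` of
`ad h`, where `σ h = -h` and the eigenvalue is nonzero: the part of `w` on eigenvalues of the same
sign is ad-nilpotent and orthogonal to the centre.

Now compress `ad x` to the span of the `e i`, `i ∈ I`, and let `w = a + i b` be a unit eigenvector
of `i` times the compression, with eigenvalue `λ` of largest modulus. The tangential sum is at most
`n λ²`, and the normal sum `D` bounds `‖[i x, w] - λ w‖²`. If `D < ε² λ²`, then `w` is an
approximate eigenvector of `ad (i x)`, so `2 ‖[a, b]‖ = ‖[w, σ w]‖ ≥ c`. This is impossible when the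
`e i` almost commute, which is an open condition satisfied on `Z_I`. Hence `D ≥ ε² λ²`, with
constants independent of `I` and of the basis. -/

open scoped RealInnerProductSpace in
/-- A nilpotent endomorphism commuting with its adjoint vanishes. -/
theorem Module.End.eq_zero_of_isNilpotent_of_commute_adjoint
    {W : Type*} [NormedAddCommGroup W] [InnerProductSpace ℝ W] {N M : Module.End ℝ W}
    (hadj : ∀ y z, ⟪N y, z⟫ = ⟪y, M z⟫) (hcomm : ∀ y, N (M y) = M (N y))
    (hN : IsNilpotent N) : N = 0 := by
  have hnorm : ∀ y, ⟪N y, N y⟫ = ⟪M y, M y⟫ := fun y => by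
    rw [hadj, ← hcomm, real_inner_comm, hadj]
  have hker : ∀ y, N (N y) = 0 → N y = 0 := fun y hy => by
    have h1 : M (N y) = 0 := by
      have := hnorm (N y)
      rw [hy, inner_zero_left] at this
      exact inner_self_eq_zero.1 this.symm
    exact inner_self_eq_zero.1 (by rw [hadj, h1, inner_zero_right] : ⟪N y, N y⟫ = 0)
  obtain ⟨k, hk⟩ := hN
  have : ∀ k : ℕ, ∀ y, (N ^ k) y = 0 → N y = 0 := by
    intro k
    induction k with
    | zero => intro y hy; simp at hy; simp [hy]
    | succ k ih =>
      intro y hy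
      rw [pow_succ, Module.End.mul_apply] at hy
      exact hker y (ih _ hy)
  ext y
  exact this k y (by rw [hk]; rfl)

/-! ### Lower bounds for `[w, σ w]` in a Lie algebra with conjugation -/

namespace ConjBracket

open scoped RealInnerProductSpace

variable {W : Type*} [NormedAddCommGroup W] [InnerProductSpace ℝ W]

theorem exists_bound [FiniteDimensional ℝ W] (γ : W →ₗ[ℝ] W →ₗ[ℝ] W) :
    ∃ K : ℝ, 0 < K ∧ ∀ x y, ‖γ x y‖ ≤ K * ‖x‖ * ‖y‖ := by
  let f : W →L[ℝ] W →L[ℝ] W :=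
    LinearMap.toContinuousLinearMap
      ((LinearMap.toContinuousLinearMap : (W →ₗ[ℝ] W) ≃ₗ[ℝ] _).toLinearMap ∘ₗ γ)
  refine ⟨‖f‖ + 1, by positivity, fun x y => ?_⟩
  have h := f.le_opNorm₂ x y
  have h2 : f x y = γ x y := rfl
  rw [h2] at h
  refine h.trans ?_
  gcongr
  linarith

theorem continuous_uncurry [FiniteDimensional ℝ W] (γ : W →ₗ[ℝ] W →ₗ[ℝ] W) :
    Continuous fun p : W × W => γ p.1 p.2 := by
  let f : W →L[ℝ] W →L[ℝ] W :=
    LinearMap.toContinuousLinearMap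
      ((LinearMap.toContinuousLinearMap : (W →ₗ[ℝ] W) ≃ₗ[ℝ] _).toLinearMap ∘ₗ γ)
  exact (f.continuous.comp continuous_fst).clm_apply continuous_snd

/-- On the elements `w` orthogonal to the centre with `ad w` nilpotent, `[w, σ w]` is bounded below
by a multiple of `‖w‖²`. -/
theorem exists_lower_bound_of_isNilpotent [FiniteDimensional ℝ W]
    (γ : W →ₗ[ℝ] W →ₗ[ℝ] W) (σ : W →ₗ[ℝ] W)
    (hjac : ∀ x y z, γ x (γ y z) = γ (γ x y) z + γ y (γ x z))
    (hinv : ∀ w y z, ⟪γ w y, z⟫ = -⟪y, γ (σ w) z⟫) :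
    ∃ c : ℝ, 0 < c ∧ ∀ w, IsNilpotent (γ w : Module.End ℝ W) →
      (∀ z, γ z = 0 → ⟪w, z⟫ = 0) → c * ‖w‖ ^ 2 ≤ ‖γ w (σ w)‖ := by
  set d := finrank ℝ W
  -- Nilpotency is expressed as the vanishing of the power `dim W`, which is a closed condition on
  -- `w`; this makes `K` compact.
  set K : Set W := Metric.sphere 0 1 ∩
    {w | (∀ y, ((γ w : Module.End ℝ W) ^ d) y = 0) ∧ ∀ z, γ z = 0 → ⟪w, z⟫ = 0}
  have hpow : ∀ n : ℕ, ∀ y, Continuous fun w => ((γ w : Module.End ℝ W) ^ n) y := by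
    intro n y
    induction n with
    | zero => simpa using continuous_const
    | succ n ih =>
      simp only [pow_succ', Module.End.mul_apply]
      exact (continuous_uncurry γ).comp (continuous_id.prodMk ih)
  have hK : IsCompact K := by
    refine (isCompact_sphere 0 1).inter_right ?_
    simp only [Set.ofPred_and, Set.ofPred_forall]
    refine (isClosed_iInter fun y => isClosed_eq (hpow d y) continuous_const).inter
      (isClosed_iInter fun z => isClosed_iInter fun _ => isClosed_eq ?_ continuous_const)
    fun_prop
  have hcont : Continuous fun w => ‖γ w (σ w)‖ :=
    ((continuous_uncurry γ).comp
      (continuous_id.prodMk (LinearMap.continuous_of_finiteDimensional σ))).norm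
  have hmem : ∀ w, w ≠ 0 → IsNilpotent (γ w : Module.End ℝ W) →
      (∀ z, γ z = 0 → ⟪w, z⟫ = 0) → ‖w‖⁻¹ • w ∈ K := by
    intro w hw hn hz
    have hw' : ‖w‖ ≠ 0 := norm_ne_zero_iff.2 hw
    refine ⟨by simp [norm_smul, hw'], fun y => ?_, fun z h => by simp [inner_smul_left, hz z h]⟩
    have : (γ w : Module.End ℝ W) ^ d = 0 := by
      have := LinearMap.aeval_self_charpoly (γ w : Module.End ℝ W)
      rwa [hn.charpoly_eq_X_pow_finrank, map_pow, Polynomial.aeval_X] at this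
    rw [map_smul, smul_pow, this]; simp
  have hpos : ∀ w ∈ K, 0 < ‖γ w (σ w)‖ := by
    rintro w ⟨hw1, hw2, hw3⟩
    refine norm_pos_iff.2 fun h0 => ?_
    -- When `[w, σ w] = 0`, Jacobi says that `ad w` commutes with its adjoint `-ad (σ w)`. Then `w`
    -- is central as well as orthogonal to the centre, which contradicts `‖w‖ = 1`.
    have h1 : (γ w : Module.End ℝ W) = 0 := by
      refine Module.End.eq_zero_of_isNilpotent_of_commute_adjoint (M := -γ (σ w)) ?_ ?_
        ⟨d, LinearMap.ext hw2⟩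
      · intro y z; simp [hinv]
      · intro y
        have := hjac w (σ w) y
        rw [h0] at this
        simp [this]
    have h2 := hw3 w h1
    rw [inner_self_eq_zero] at h2
    simp [h2] at hw1
  rcases K.eq_empty_or_nonempty with he | hne
  · refine ⟨1, one_pos, fun w hn hz => ?_⟩
    by_cases hw : w = 0
    · simp [hw]
    · exact absurd (hmem w hw hn hz) (by simp [he])
  · obtain ⟨w₀, hw₀, hmin⟩ := hK.exists_isMinOn hne hcont.continuousOn
    refine ⟨_, hpos w₀ hw₀, fun w hn hz => ?_⟩
    by_cases hw : w = 0
    · simp [hw]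
    · have h := hmin (hmem w hw hn hz)
      have hw' : 0 < ‖w‖ := norm_pos_iff.2 hw
      simp only [map_smul, LinearMap.smul_apply, norm_smul, norm_inv, norm_norm,
        Set.mem_ofPred_eq] at h
      rw [← mul_assoc, ← mul_inv, inv_mul_eq_div, le_div_iff₀ (by positivity)] at h
      linarith [sq ‖w‖]

/-- If `γ h` is a diagonal derivation, then `γ w` raises the eigenvalue by at least `δ` when `w` is
supported on eigenvalues at least `δ`. -/
theorem inner_apply_eq_zero_of_lt {ι : Type*} [Fintype ι] (γ : W →ₗ[ℝ] W →ₗ[ℝ] W)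
    (hjac : ∀ x y z, γ x (γ y z) = γ (γ x y) z + γ y (γ x z)) {h : W}
    (hsymm : ∀ y z, ⟪γ h y, z⟫ = ⟪y, γ h z⟫) (b : OrthonormalBasis ι ℝ W) (μ : ι → ℝ)
    (hb : ∀ i, γ h (b i) = μ i • b i) {w z : W} {δ s : ℝ}
    (hw : ∀ i, μ i < δ → ⟪b i, w⟫ = 0) (hz : ∀ i, μ i < s → ⟪b i, z⟫ = 0) (l : ι)
    (hl : μ l < s + δ) : ⟪b l, γ w z⟫ = 0 := by
  rw [← b.sum_repr' w, ← b.sum_repr' z]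
  simp only [map_sum, LinearMap.sum_apply, inner_sum, map_smul, LinearMap.smul_apply,
    inner_smul_right, Finset.mul_sum]
  refine Finset.sum_eq_zero fun i _ => Finset.sum_eq_zero fun k _ => ?_
  by_cases hi : μ k < δ
  · simp [hw k hi]
  by_cases hk : μ i < s
  · simp [hz i hk]
  -- Brackets add eigenvalues, so `[b k, b i]` is orthogonal to `b l` unless `μ l = μ k + μ i`.
  have h1 : ⟪b l, γ h (γ (b k) (b i))⟫ = (μ k + μ i) * ⟪b l, γ (b k) (b i)⟫ := by
    rw [hjac, hb, hb, map_smul, map_smul, LinearMap.smul_apply, ← add_smul, inner_smul_right]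
  rw [← hsymm, hb, inner_smul_left] at h1
  have h2 : (μ k + μ i - μ l) * ⟪b l, γ (b k) (b i)⟫ = 0 := by
    simp only [conj_trivial] at h1
    linarith
  rcases mul_eq_zero.1 h2 with h3 | h3
  · exfalso; linarith
  · simp [h3]

/-- Each application of `ad w` raises the lowest eigenvalue present by at least the smallest
positive eigenvalue, so after finitely many applications it has left the bounded spectrum. -/
theorem isNilpotent_of_pos {ι : Type*} [Fintype ι] (γ : W →ₗ[ℝ] W →ₗ[ℝ] W)
    (hjac : ∀ x y z, γ x (γ y z) = γ (γ x y) z + γ y (γ x z)) {h : W}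
    (hsymm : ∀ y z, ⟪γ h y, z⟫ = ⟪y, γ h z⟫) (b : OrthonormalBasis ι ℝ W) (μ : ι → ℝ)
    (hb : ∀ i, γ h (b i) = μ i • b i) {w : W} (hw : ∀ i, μ i ≤ 0 → ⟪b i, w⟫ = 0) :
    IsNilpotent (γ w : Module.End ℝ W) := by
  obtain ⟨δ, hδ, hδ0⟩ : ∃ δ : ℝ, (∀ i, 0 < μ i → δ ≤ μ i) ∧ 0 < δ := by
    refine ((Filter.eventually_all.2 fun i => ?_).and
      (self_mem_nhdsWithin : ∀ᶠ δ in nhdsWithin (0 : ℝ) (Set.Ioi 0), 0 < δ)).exists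
    by_cases hi : 0 < μ i
    · filter_upwards [nhdsWithin_le_nhds (eventually_le_nhds hi)] with δ h _ using h
    · simp [hi]
  obtain ⟨M, hM⟩ : ∃ M : ℝ, ∀ i, |μ i| ≤ M :=
    (Filter.eventually_all.2 fun i => Filter.eventually_ge_atTop |μ i|).exists
  have hw' : ∀ i, μ i < δ → ⟪b i, w⟫ = 0 := fun i hi =>
    hw i (not_lt.1 fun h0 => (hδ i h0).not_gt hi)
  have key : ∀ (n : ℕ) (z : W) (i : ι), μ i < -M + n * δ →
      ⟪b i, ((γ w : Module.End ℝ W) ^ n) z⟫ = 0 := by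
    intro n z
    induction n with
    | zero =>
      intro i hi
      have := neg_le_of_abs_le (hM i)
      simp at hi
      linarith
    | succ n ih =>
      intro i hi
      rw [pow_succ', Module.End.mul_apply]
      refine inner_apply_eq_zero_of_lt γ hjac hsymm b μ hb hw' ih i ?_
      push_cast at hi
      linarith
  obtain ⟨n, hn⟩ := exists_nat_gt (2 * M / δ)
  rw [div_lt_iff₀ hδ0] at hn
  refine ⟨n, LinearMap.ext fun z => b.toBasis.ext_elem fun i => ?_⟩
  have := key n z i (by linarith [le_of_abs_le (hM i)])
  simpa [b.repr_apply_apply] using this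

theorem norm_sq_eq_sum {ι : Type*} [Fintype ι] (b : OrthonormalBasis ι ℝ W) (x : W) :
    ‖x‖ ^ 2 = ∑ i, ⟪b i, x⟫ ^ 2 := by
  rw [← b.sum_sq_norm_inner_right]
  simp

/-- If `w` is nearly an eigenvector, with nonzero eigenvalue, of a symmetric inner derivation,
then `[w, σ w]` is bounded below by a multiple of `‖w‖²`. -/
theorem exists_lower_bound_of_almost_eigenvector [FiniteDimensional ℝ W]
    (γ : W →ₗ[ℝ] W →ₗ[ℝ] W) (σ : W →ₗ[ℝ] W)
    (hskew : ∀ x y, γ x y = -γ y x)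
    (hjac : ∀ x y z, γ x (γ y z) = γ (γ x y) z + γ y (γ x z))
    (hσ : ∀ x, ‖σ x‖ = ‖x‖)
    (hinv : ∀ w y z, ⟪γ w y, z⟫ = -⟪y, γ (σ w) z⟫) :
    ∃ ε c : ℝ, 0 < ε ∧ 0 < c ∧ ∀ h, σ h = -h → ∀ (lam : ℝ) (w : W), lam ≠ 0 →
      ‖γ h w - lam • w‖ ≤ ε * |lam| * ‖w‖ → c * ‖w‖ ^ 2 ≤ ‖γ w (σ w)‖ := by
  obtain ⟨c, hc, hlow⟩ := exists_lower_bound_of_isNilpotent γ σ hjac hinv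
  obtain ⟨K, hK, hbd⟩ := exists_bound γ
  -- The bound `ε ≤ 1 / 2` keeps at least half the norm of `w` in its positive part, which gives `c
  -- / 4`. Replacing `w` by that part costs at most `3 K ε ‖w‖²`, so `c / 8` remains.
  obtain ⟨ε, hε0, hε1, hε2⟩ : ∃ ε : ℝ, 0 < ε ∧ ε ≤ 1 / 2 ∧ 3 * K * ε ≤ c / 8 :=
    ⟨min (1 / 2) (c / (24 * K)), by positivity, min_le_left _ _, by
      have := mul_le_mul_of_nonneg_left (min_le_right (1 / 2) (c / (24 * K)))
        (by positivity : 0 ≤ 3 * K)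
      refine this.trans (le_of_eq ?_)
      field_simp
      norm_num⟩
  refine ⟨ε, c / 8, hε0, by positivity, ?_⟩
  have main : ∀ h, σ h = -h → ∀ (lam : ℝ) (w : W), 0 < lam →
      ‖γ h w - lam • w‖ ≤ ε * lam * ‖w‖ → c / 8 * ‖w‖ ^ 2 ≤ ‖γ w (σ w)‖ := by
    intro h hh lam w hlam hw
    have hsymm : ∀ y z, ⟪γ h y, z⟫ = ⟪y, γ h z⟫ := fun y z => by simp [hinv, hh]
    have hT : LinearMap.IsSymmetric (γ h) := hsymm
    set b := hT.eigenvectorBasis rfl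
    set μ := hT.eigenvalues rfl
    have hb : ∀ i, γ h (b i) = μ i • b i := fun i => hT.apply_eigenvectorBasis rfl i
    set wp : W := ∑ i, (if 0 < μ i then ⟪b i, w⟫ else 0) • b i
    have hwp : ∀ i, ⟪b i, wp⟫ = if 0 < μ i then ⟪b i, w⟫ else 0 := fun i => by
      simp only [wp, b.orthonormal.inner_right_fintype]
    set r : W := w - wp
    have hr : ∀ i, ⟪b i, r⟫ = if 0 < μ i then 0 else ⟪b i, w⟫ := fun i => by
      simp only [r, inner_sub_right, hwp]
      split_ifs <;> simp
    have hwp0 : ∀ i, μ i ≤ 0 → ⟪b i, wp⟫ = 0 := fun i hi => by rw [hwp, if_neg hi.not_gt]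
    -- On eigenvalues `μ i ≤ 0` one has `|μ i - lam| ≥ lam`, so the eigenvector defect controls `r`.
    have hrn : ‖r‖ ≤ ε * ‖w‖ := by
      have h1 : lam ^ 2 * ‖r‖ ^ 2 ≤ ‖γ h w - lam • w‖ ^ 2 := by
        rw [norm_sq_eq_sum b r, norm_sq_eq_sum b (γ h w - lam • w), Finset.mul_sum]
        refine Finset.sum_le_sum fun i _ => ?_
        rw [hr, inner_sub_right, ← hsymm, hb, inner_smul_left, inner_smul_right]
        simp only [conj_trivial]
        split_ifs with hi
        · simp; positivity
        · rw [← mul_pow, sq_le_sq, ← sub_mul, abs_mul, abs_mul]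
          refine mul_le_mul_of_nonneg_right ?_ (abs_nonneg _)
          rw [abs_of_pos hlam, abs_sub_comm]
          exact (by linarith : lam ≤ lam - μ i).trans (le_abs_self _)
      rw [← mul_pow] at h1
      have h2 := (pow_le_pow_iff_left₀ (by positivity) (by positivity) two_ne_zero).1 h1
      have h3 : lam * ‖r‖ ≤ lam * (ε * ‖w‖) := by linarith
      exact le_of_mul_le_mul_left h3 hlam
    have hnil := isNilpotent_of_pos γ hjac hsymm b μ hb hwp0
    -- The centre lies in the kernel of the symmetric map `ad h`, hence is orthogonal to
    -- eigenvectors with nonzero eigenvalue.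
    have hcen : ∀ z, γ z = 0 → ⟪wp, z⟫ = 0 := fun z hz => by
      rw [← b.sum_inner_mul_inner]
      refine Finset.sum_eq_zero fun i _ => ?_
      by_cases hi : μ i ≤ 0
      · rw [real_inner_comm, hwp0 i hi, zero_mul]
      · have h1 : ⟪γ h (b i), z⟫ = 0 := by
          rw [hsymm, hskew, hz]; simp
        rw [hb, inner_smul_left] at h1
        rcases mul_eq_zero.1 h1 with h2 | h2
        · exact absurd (le_of_eq h2) hi
        · rw [h2, mul_zero]
    have hwe : w = wp + r := by simp [r]
    have h1 := hlow wp hnil hcen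
    have hn1 : ‖w‖ ≤ ‖wp‖ + ‖r‖ := by
      conv_lhs => rw [hwe]
      exact norm_add_le _ _
    have hn2 : ‖wp‖ ≤ ‖w‖ + ‖r‖ := by
      rw [show wp = w - r by simp [r]]
      exact norm_sub_le _ _
    have hw0 := norm_nonneg w
    have hn3 : ‖w‖ / 2 ≤ ‖wp‖ := by nlinarith
    have hn4 : ‖wp‖ ≤ 2 * ‖w‖ := by nlinarith
    have h2 : γ wp (σ wp) = γ w (σ w) - γ r (σ w) - γ wp (σ r) := by
      have e1 : γ w (σ w) = γ wp (σ w) + γ r (σ w) := by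
        conv_lhs => rw [hwe]
        rw [map_add γ, LinearMap.add_apply, ← hwe]
      have e2 : γ wp (σ w) = γ wp (σ wp) + γ wp (σ r) := by
        conv_lhs => rw [hwe]
        rw [map_add, map_add]
      rw [e1, e2]; abel
    have h3 : ‖γ wp (σ wp)‖ ≤ ‖γ w (σ w)‖ + ‖γ r (σ w)‖ + ‖γ wp (σ r)‖ := by
      rw [h2]
      exact (norm_sub_le _ _).trans (by gcongr; exact norm_sub_le _ _)
    have h4 : ‖γ r (σ w)‖ ≤ K * (ε * ‖w‖) * ‖w‖ := by
      refine (hbd _ _).trans ?_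
      rw [hσ]; gcongr
    have h5 : ‖γ wp (σ r)‖ ≤ K * (2 * ‖w‖) * (ε * ‖w‖) := by
      refine (hbd _ _).trans ?_
      rw [hσ]; gcongr
    have h6 : c * (‖w‖ / 2) ^ 2 ≤ c * ‖wp‖ ^ 2 := by gcongr
    have h7 : 3 * K * ε * ‖w‖ ^ 2 ≤ c / 8 * ‖w‖ ^ 2 := by gcongr
    nlinarith
  intro h hh lam w hlam hw
  rcases hlam.lt_or_gt with hneg | hpos
  · refine main (-h) (by rw [map_neg, hh]) (-lam) w (by linarith) ?_
    rw [abs_of_neg hneg] at hw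
    refine (le_of_eq ?_).trans hw
    rw [← norm_neg]
    congr 1
    simp only [map_neg, LinearMap.neg_apply, neg_smul]
    abel
  · exact main h hh lam w hpos (by rwa [abs_of_pos hpos] at hw)

end ConjBracket

/-! ### Complexification and the tangential-normal estimate -/

namespace ConjBracket

open scoped RealInnerProductSpace

variable {V : Type*} [NormedAddCommGroup V] [InnerProductSpace ℝ V]

@[ext]
theorem withLp_prod_ext {V : Type*} {x y : WithLp 2 (V × V)} (h₁ : x.fst = y.fst)
    (h₂ : x.snd = y.snd) : x = y :=
  (WithLp.ofLp_injective 2) (Prod.ext h₁ h₂)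

/-- The complex bilinear extension of a bracket on `V` to `V × V ≃ V ⊗ ℂ`. -/
noncomputable def complexify (β : V →ₗ[ℝ] V →ₗ[ℝ] V) :
    WithLp 2 (V × V) →ₗ[ℝ] WithLp 2 (V × V) →ₗ[ℝ] WithLp 2 (V × V) :=
  LinearMap.mk₂ ℝ (fun x y => WithLp.toLp 2
      (β x.fst y.fst - β x.snd y.snd, β x.fst y.snd + β x.snd y.fst))
    (fun x x' y => by ext <;> simp <;> abel)
    (fun c x y => by ext <;> simp [smul_sub, smul_add])
    (fun x y y' => by ext <;> simp <;> abel)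
    (fun c x y => by ext <;> simp [smul_sub, smul_add])

theorem complexify_apply (β : V →ₗ[ℝ] V →ₗ[ℝ] V) (x y : WithLp 2 (V × V)) :
    complexify β x y = WithLp.toLp 2
      (β x.fst y.fst - β x.snd y.snd, β x.fst y.snd + β x.snd y.fst) := rfl

/-- Complex conjugation on `V × V ≃ V ⊗ ℂ`. -/
def conj : WithLp 2 (V × V) →ₗ[ℝ] WithLp 2 (V × V) where
  toFun x := WithLp.toLp 2 (x.fst, -x.snd)
  map_add' x y := by ext <;> simp; abel
  map_smul' c x := by ext <;> simp

theorem conj_apply (x : WithLp 2 (V × V)) : conj x = WithLp.toLp 2 (x.fst, -x.snd) := rfl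

theorem norm_conj (x : WithLp 2 (V × V)) : ‖conj x‖ = ‖x‖ := by
  simp [conj_apply, WithLp.prod_norm_eq_of_L2]

theorem complexify_skew {β : V →ₗ[ℝ] V →ₗ[ℝ] V} (h : ∀ x y, β x y = -β y x)
    (x y : WithLp 2 (V × V)) : complexify β x y = -complexify β y x := by
  simp only [complexify_apply]
  rw [h x.fst, h x.snd, h x.fst y.snd, h x.snd]
  ext <;> simp; abel

theorem complexify_jacobi {β : V →ₗ[ℝ] V →ₗ[ℝ] V}
    (h : ∀ x y z, β x (β y z) = β (β x y) z + β y (β x z)) (x y z : WithLp 2 (V × V)) :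
    complexify β x (complexify β y z) =
      complexify β (complexify β x y) z + complexify β y (complexify β x z) := by
  simp only [complexify_apply]
  ext <;> simp [h x.fst, h x.snd] <;> abel

/-- The inner product is the real part of the Hermitian extension, so passing to the adjoint
conjugates the coefficient `i` in `w`. -/
theorem complexify_inner {β : V →ₗ[ℝ] V →ₗ[ℝ] V} (h : ∀ x y z, ⟪β x y, z⟫ = -⟪y, β x z⟫)
    (w y z : WithLp 2 (V × V)) :
    ⟪complexify β w y, z⟫ = -⟪y, complexify β (conj w) z⟫ := by
  simp only [complexify_apply, conj_apply, WithLp.prod_inner_apply, inner_sub_left,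
    inner_add_left, inner_sub_right, inner_add_right, h, map_neg, LinearMap.neg_apply,
    inner_neg_right, WithLp.ofLp_fst, WithLp.ofLp_snd, WithLp.toLp_fst, WithLp.toLp_snd]
  ring

/-- `i • S` acting on `V × V ≃ V ⊗ ℂ`. -/
def rot (S : V →ₗ[ℝ] V) : WithLp 2 (V × V) →ₗ[ℝ] WithLp 2 (V × V) where
  toFun x := WithLp.toLp 2 (-S x.snd, S x.fst)
  map_add' x y := by ext <;> simp; abel
  map_smul' c x := by ext <;> simp

theorem rot_apply (S : V →ₗ[ℝ] V) (x : WithLp 2 (V × V)) :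
    rot S x = WithLp.toLp 2 (-S x.snd, S x.fst) := rfl

theorem complexify_imaginary (β : V →ₗ[ℝ] V →ₗ[ℝ] V) (x : V) :
    complexify β (WithLp.toLp 2 (0, x)) = rot (β x) := by
  ext y <;> simp [complexify_apply, rot_apply]

theorem isSymmetric_rot {S : V →ₗ[ℝ] V} (hS : ∀ y z, ⟪S y, z⟫ = -⟪y, S z⟫) :
    (rot S).IsSymmetric := by
  intro y z
  simp [rot_apply, WithLp.prod_inner_apply, hS]
  ring

theorem norm_sq_withLp {V : Type*} [NormedAddCommGroup V] (x : WithLp 2 (V × V)) :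
    ‖x‖ ^ 2 = ‖x.fst‖ ^ 2 + ‖x.snd‖ ^ 2 := by
  rw [WithLp.prod_norm_eq_of_L2, Real.sq_sqrt (by positivity)]

/-- A symmetric operator on a nontrivial finite-dimensional space has an eigenvalue of maximal
modulus, which bounds its norm. -/
theorem exists_top_eigenvector {W : Type*} [NormedAddCommGroup W] [InnerProductSpace ℝ W]
    [FiniteDimensional ℝ W] [Nontrivial W] {T : W →ₗ[ℝ] W} (hT : T.IsSymmetric) :
    ∃ (lam : ℝ) (w : W), ‖w‖ = 1 ∧ T w = lam • w ∧ ∀ z, ‖T z‖ ^ 2 ≤ lam ^ 2 * ‖z‖ ^ 2 := by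
  set b := hT.eigenvectorBasis rfl
  set μ := hT.eigenvalues rfl
  have hb : ∀ i, T (b i) = μ i • b i := fun i => hT.apply_eigenvectorBasis rfl i
  have : Nonempty (Fin (finrank ℝ W)) := ⟨⟨0, finrank_pos⟩⟩
  obtain ⟨i, hi⟩ := Finite.exists_max fun i => |μ i|
  refine ⟨μ i, b i, b.orthonormal.1 i, hb i, fun z => ?_⟩
  rw [norm_sq_eq_sum b (T z), norm_sq_eq_sum b z, Finset.mul_sum]
  refine Finset.sum_le_sum fun k _ => ?_
  rw [← hT, hb, inner_smul_left, mul_pow]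
  exact mul_le_mul_of_nonneg_right (sq_le_sq.2 (hi k)) (sq_nonneg _)

/-- For a finite-dimensional real Lie algebra with invariant inner product and an orthonormal
basis whose vectors indexed by `I` almost commute, the tangential part of `ad x` on their span is
controlled by the normal part. -/
theorem exists_tangential_le_normal [FiniteDimensional ℝ V] {ι : Type*} [Fintype ι]
    [DecidableEq ι] (β : V →ₗ[ℝ] V →ₗ[ℝ] V)
    (hskew : ∀ x y, β x y = -β y x)
    (hjac : ∀ x y z, β x (β y z) = β (β x y) z + β y (β x z))
    (hinv : ∀ x y z, ⟪β x y, z⟫ = -⟪y, β x z⟫) :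
    ∃ C δ : ℝ, 0 < C ∧ 0 < δ ∧ ∀ (e : OrthonormalBasis ι ℝ V) (I : Finset ι) (x : V),
      (∀ i ∈ I, ∀ j ∈ I, ‖β (e i) (e j)‖ ≤ δ) →
      ∑ j ∈ I, ∑ k ∈ I, ⟪β x (e j), e k⟫ ^ 2 ≤ C * ∑ j ∈ I, ∑ k ∈ Iᶜ, ⟪β x (e j), e k⟫ ^ 2 := by
  obtain ⟨ε, c, hε, hc, key⟩ := exists_lower_bound_of_almost_eigenvector (complexify β) conj
    (complexify_skew hskew) (complexify_jacobi hjac) norm_conj (complexify_inner hinv)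
  set n : ℝ := (Fintype.card ι : ℝ)
  have hn : 0 ≤ n := Nat.cast_nonneg _
  -- The second constant makes `‖[a, b]‖ ≤ c / 4` for `a`, `b` in the unit ball of the span, since
  -- the expansion has at most `n²` terms. Using `n + 1` keeps both constants positive and well
  -- defined when `n = 0`.
  refine ⟨(n + 1) / ε ^ 2, c / (4 * (n + 1) ^ 2), by positivity, by positivity, ?_⟩
  intro e I x hI
  set D := ∑ j ∈ I, ∑ k ∈ Iᶜ, ⟪β x (e j), e k⟫ ^ 2 with hD
  have hD0 : 0 ≤ D := Finset.sum_nonneg fun _ _ => Finset.sum_nonneg fun _ _ => sq_nonneg _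
  have hIn : (I.card : ℝ) ≤ n := Nat.cast_le.2 I.card_le_univ
  rcases I.eq_empty_or_nonempty with rfl | ⟨i₀, hi₀⟩
  · simp; positivity
  let P : V →ₗ[ℝ] V := ∑ j ∈ I, (innerₛₗ ℝ (e j)).smulRight (e j)
  have hP : ∀ z, P z = ∑ j ∈ I, ⟪e j, z⟫ • e j := fun z => by simp [P]
  have heP : ∀ k z, ⟪e k, P z⟫ = if k ∈ I then ⟪e k, z⟫ else 0 := fun k z => by
    simp [hP, inner_sum, inner_smul_right, e.inner_eq_ite]
  have hPP : ∀ z, P (P z) = P z := fun z => e.toBasis.ext_elem fun k => by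
    simp only [e.coe_toBasis_repr_apply, e.repr_apply_apply, heP]
    split_ifs <;> rfl
  have hPs : ∀ y z, ⟪P y, z⟫ = ⟪y, P z⟫ := fun y z => by
    simp only [hP, inner_sum, sum_inner, inner_smul_left, inner_smul_right, conj_trivial]
    exact Finset.sum_congr rfl fun j _ => by rw [real_inner_comm y, mul_comm]
  have hPe : ∀ j ∈ I, P (e j) = e j := fun j hj => e.toBasis.ext_elem fun k => by
    rw [e.coe_toBasis_repr_apply, e.coe_toBasis_repr_apply, e.repr_apply_apply,
      e.repr_apply_apply, heP, e.inner_eq_ite]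
    by_cases hk : k ∈ I
    · rw [if_pos hk]
    · rw [if_neg hk, if_neg (fun h : k = j => hk (h ▸ hj))]
  let S : V →ₗ[ℝ] V := P ∘ₗ β x ∘ₗ P
  have hS : ∀ z, S z = P (β x (P z)) := fun _ => rfl
  have hSs : ∀ y z, ⟪S y, z⟫ = -⟪y, S z⟫ := fun y z => by
    rw [hS, hS, hPs, hinv, hPs]
  have hT := isSymmetric_rot hSs
  have : Nontrivial (WithLp 2 (V × V)) :=
    ⟨⟨WithLp.toLp 2 (e i₀, 0), 0, fun h => by
      have := congrArg (fun y : WithLp 2 (V × V) => y.fst) h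
      exact e.orthonormal.ne_zero i₀ (by simpa using this)⟩⟩
  obtain ⟨lam, w, hw1, hw, hmax⟩ := exists_top_eigenvector hT
  -- For `j ∈ I` the inner sum is `‖S (e j)‖²`, and `lam ^ 2` bounds it because `|lam|` is the
  -- operator norm of `rot S`.
  have hL : ∑ j ∈ I, ∑ k ∈ I, ⟪β x (e j), e k⟫ ^ 2 ≤ n * lam ^ 2 := by
    have : ∀ j ∈ I, ∑ k ∈ I, ⟪β x (e j), e k⟫ ^ 2 ≤ lam ^ 2 := fun j hj => by
      have h1 := hmax (WithLp.toLp 2 (e j, 0))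
      rw [norm_sq_withLp, norm_sq_withLp] at h1
      simp only [rot_apply, WithLp.toLp_fst, WithLp.toLp_snd, map_zero, neg_zero, norm_zero,
        e.orthonormal.1 j, hS, hPe j hj, norm_sq_eq_sum e (P _), heP] at h1
      simp only [ite_pow, ne_eq, OfNat.ofNat_ne_zero, not_false_eq_true, zero_pow,
        Finset.sum_ite_mem, Finset.univ_inter] at h1
      simp only [real_inner_comm]
      linarith
    refine (Finset.sum_le_card_nsmul _ _ _ this).trans ?_
    rw [nsmul_eq_mul]
    gcongr
  by_cases hlam : lam = 0
  · rw [hlam] at hL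
    refine hL.trans ?_
    simp; positivity
  have hw' : WithLp.toLp 2 (-S w.snd, S w.fst) = lam • w := hw
  have ha : -S w.snd = lam • w.fst := congrArg (fun y : WithLp 2 (V × V) => y.fst) hw'
  have hb : S w.fst = lam • w.snd := congrArg (fun y : WithLp 2 (V × V) => y.snd) hw'
  have hPS : ∀ z, P (S z) = S z := fun z => by rw [hS, hPP]
  -- As `lam ≠ 0`, both components of `w` lie in the range of `S`, hence in the span of the `e i`
  -- with `i ∈ I`.
  have hPa : P w.fst = w.fst := smul_right_injective V hlam <| by
    simp only
    rw [← map_smul, ← ha, map_neg, hPS]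
  have hPb : P w.snd = w.snd := smul_right_injective V hlam <| by
    simp only
    rw [← map_smul, ← hb, hPS]
  have hnormal : ∀ a, P a = a → ‖β x a - S a‖ ^ 2 ≤ ‖a‖ ^ 2 * D := fun a hPa => by
    have h1 : ∀ k, ⟪e k, β x a - S a⟫ = if k ∈ Iᶜ then ⟪β x a, e k⟫ else 0 := fun k => by
      rw [inner_sub_right, hS, heP, hPa, real_inner_comm]
      by_cases hk : k ∈ I <;> simp [hk]
    have h2 : ∀ k, ⟪β x a, e k⟫ ^ 2 ≤ ‖a‖ ^ 2 * ∑ j ∈ I, ⟪β x (e j), e k⟫ ^ 2 := fun k => by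
      have h3 : ⟪β x a, e k⟫ = ∑ j ∈ I, ⟪e j, a⟫ * ⟪β x (e j), e k⟫ := by
        conv_lhs => rw [← hPa, hP]
        simp [map_sum, sum_inner, inner_smul_left]
      rw [h3]
      refine (Finset.sum_mul_sq_le_sq_mul_sq _ _ _).trans ?_
      refine mul_le_mul_of_nonneg_right ?_ (Finset.sum_nonneg fun _ _ => sq_nonneg _)
      rw [norm_sq_eq_sum e a]
      exact Finset.sum_le_univ_sum_of_nonneg fun _ => sq_nonneg _
    rw [norm_sq_eq_sum e, hD, Finset.sum_comm, Finset.mul_sum]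
    simp only [h1, ite_pow, ne_eq, OfNat.ofNat_ne_zero, not_false_eq_true, zero_pow,
      Finset.sum_ite_mem, Finset.univ_inter]
    exact Finset.sum_le_sum fun k _ => h2 k
  have hab := norm_sq_withLp w
  rw [hw1, one_pow] at hab
  -- The defect is exactly the normal component of `ad x` on the two parts of `w`; Cauchy–Schwarz
  -- bounds it by `D`.
  have hTw : ‖complexify β (WithLp.toLp 2 (0, x)) w - lam • w‖ ^ 2 ≤ D := by
    rw [complexify_imaginary, ← hw, norm_sq_withLp]
    have e1 : (rot (β x) w - rot S w).fst = -(β x w.snd - S w.snd) := by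
      simp [rot_apply]; abel
    have e2 : (rot (β x) w - rot S w).snd = β x w.fst - S w.fst := by
      simp [rot_apply]
    rw [e1, e2, norm_neg]
    calc _ ≤ ‖w.snd‖ ^ 2 * D + ‖w.fst‖ ^ 2 * D := add_le_add (hnormal _ hPb) (hnormal _ hPa)
      _ = (‖w.fst‖ ^ 2 + ‖w.snd‖ ^ 2) * D := by ring
      _ = D := by rw [← hab, one_mul]
  have hDlow : ε ^ 2 * lam ^ 2 ≤ D := by
    by_contra! hlt
    have h1 := key (WithLp.toLp 2 (0, x)) (by ext <;> simp [conj_apply]) lam w hlam (by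
      rw [hw1, mul_one]
      refine abs_le_of_sq_le_sq' ?_ (by positivity) |>.2
      rw [mul_pow, sq_abs]
      exact hTw.trans hlt.le)
    have hcoef : ∀ a : V, ‖a‖ ≤ 1 → ∀ j, |⟪e j, a⟫| ≤ 1 := fun a h j =>
      (abs_real_inner_le_norm _ _).trans (by rw [e.orthonormal.1 j, one_mul]; exact h)
    have hna : ‖w.fst‖ ≤ 1 := by nlinarith [norm_nonneg w.fst, norm_nonneg w.snd]
    have hnb : ‖w.snd‖ ≤ 1 := by nlinarith [norm_nonneg w.fst, norm_nonneg w.snd]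
    have h2 : ‖β w.fst w.snd‖ ≤ n * (n * (c / (4 * (n + 1) ^ 2))) := by
      conv_lhs => rw [← hPa, ← hPb, hP, hP]
      simp only [map_sum, LinearMap.sum_apply, map_smul, LinearMap.smul_apply, Finset.smul_sum]
      refine (norm_sum_le_of_le _ (n := fun _ => n * (c / (4 * (n + 1) ^ 2)))
        fun j hj => ?_).trans ?_
      · refine (norm_sum_le_of_le _ (n := fun _ => c / (4 * (n + 1) ^ 2)) fun k hk => ?_).trans ?_
        · rw [norm_smul, norm_smul]
          calc _ ≤ 1 * (1 * (c / (4 * (n + 1) ^ 2))) := by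
                gcongr
                · exact hcoef _ hnb _
                · exact hcoef _ hna _
                · exact hI _ hk _ hj
            _ = _ := by ring
        · rw [Finset.sum_const, nsmul_eq_mul]; gcongr
      · rw [Finset.sum_const, nsmul_eq_mul]; gcongr
    -- This is `[a + i b, a - i b] = -2 i [a, b]`.
    have h3 : complexify β w (conj w) = WithLp.toLp 2 (0, -(2 : ℝ) • β w.fst w.snd) := by
      have h4 : ∀ y, β y y = 0 := fun y => by
        have h := hskew y y
        rwa [eq_neg_iff_add_eq_zero, ← two_smul ℝ, smul_eq_zero_iff_right two_ne_zero] at h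
      ext
      · simp [complexify_apply, conj_apply, h4]
      · simp only [complexify_apply, conj_apply, WithLp.toLp_snd, WithLp.toLp_fst, map_neg]
        rw [hskew w.snd w.fst, neg_smul, two_smul]
        abel
    have h5 : ‖complexify β w (conj w)‖ ^ 2 = (2 * ‖β w.fst w.snd‖) ^ 2 := by
      rw [h3, norm_sq_withLp]
      simp [norm_smul]
    rw [pow_left_inj₀ (by positivity) (by positivity) two_ne_zero] at h5
    rw [h5, hw1, one_pow, mul_one] at h1
    have h6 : n * (n * (c / (4 * (n + 1) ^ 2))) ≤ c / 4 := by
      rw [← mul_assoc, ← mul_div_assoc, div_le_div_iff₀ (by positivity) (by positivity)]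
      nlinarith [mul_nonneg hn hc.le]
    linarith
  calc _ ≤ n * lam ^ 2 := hL
    _ ≤ (n + 1) * lam ^ 2 := by gcongr; linarith
    _ = (n + 1) / ε ^ 2 * (ε ^ 2 * lam ^ 2) := by field_simp
    _ ≤ _ := by gcongr

end ConjBracket

/-! ### From bi-invariance to `ad`-invariance: the local computation -/

set_option synthInstance.maxHeartbeats 200000 in
theorem hasFDerivAt_ringInverse_one {A : Type*} [NormedRing A] [NormedAlgebra ℝ A]
    [HasSummableGeomSeries A] :
    HasFDerivAt (Ring.inverse : A → A) (-ContinuousLinearMap.id ℝ A) 1 := by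
  have h := hasFDerivAt_ringInverse (𝕜 := ℝ) (1 : Aˣ)
  rw [inv_one, Units.val_one] at h
  refine h.congr_fderiv (ContinuousLinearMap.ext fun x => ?_)
  simp

open scoped Topology in
/-- The infinitesimal form of the invariance of a bilinear form under the adjoint action, for a
local multiplication `m` with unit `p₀` on a vector space. -/
theorem lieBracket_skew_of_local_mul {E : Type*} [NormedAddCommGroup E] [NormedSpace ℝ E]
    [CompleteSpace E] (m : E × E → E) (p₀ : E) (hm : ContDiffAt ℝ 2 m (p₀, p₀))
    (hleft : ∀ᶠ p in 𝓝 p₀, m (p₀, p) = p) (hright : ∀ᶠ p in 𝓝 p₀, m (p, p₀) = p)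
    (B : E →L[ℝ] E →L[ℝ] ℝ)
    (hB : ∀ᶠ p in 𝓝 p₀, ∀ v w y z, fderiv ℝ m (p, p₀) (0, v) = fderiv ℝ m (p₀, p) (y, 0) →
      fderiv ℝ m (p, p₀) (0, w) = fderiv ℝ m (p₀, p) (z, 0) → B v w = B y z) (x y z : E) :
    B (VectorField.lieBracket ℝ (fun p => fderiv ℝ m (p, p₀) (0, x))
        (fun p => fderiv ℝ m (p, p₀) (0, y)) p₀) z =
      -B y (VectorField.lieBracket ℝ (fun p => fderiv ℝ m (p, p₀) (0, x))
        (fun p => fderiv ℝ m (p, p₀) (0, z)) p₀) := by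
  have hmd : DifferentiableAt ℝ m (p₀, p₀) := hm.differentiableAt two_ne_zero
  have hD : DifferentiableAt ℝ (fderiv ℝ m) (p₀, p₀) :=
    (hm.fderiv_right (m := 1) (by norm_num)).differentiableAt one_ne_zero
  set D := fderiv ℝ (fderiv ℝ m) (p₀, p₀)
  have hsymm : ∀ v w, D v w = D w v := fun v w =>
    (hm.isSymmSndFDerivAt (by simp)).eq v w
  let inl := ContinuousLinearMap.inl ℝ E E
  let inr := ContinuousLinearMap.inr ℝ E E
  let L : E → E →L[ℝ] E := fun p => (fderiv ℝ m (p, p₀)).comp inr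
  let R : E → E →L[ℝ] E := fun p => (fderiv ℝ m (p₀, p)).comp inl
  have hp1 : HasFDerivAt (fun p : E => (p, p₀)) inl p₀ := hasFDerivAt_prodMk_left p₀ p₀
  have hp2 : HasFDerivAt (fun p : E => (p₀, p)) inr p₀ := hasFDerivAt_prodMk_right p₀ p₀
  have hL1 : HasFDerivAt (fun p => fderiv ℝ m (p, p₀)) (D.comp inl) p₀ :=
    HasFDerivAt.comp p₀ (f := fun p : E => (p, p₀)) hD.hasFDerivAt hp1
  have hR1 : HasFDerivAt (fun p => fderiv ℝ m (p₀, p)) (D.comp inr) p₀ :=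
    HasFDerivAt.comp p₀ (f := fun p : E => (p₀, p)) hD.hasFDerivAt hp2
  obtain ⟨L', hL, hL'⟩ : ∃ L' : E →L[ℝ] E →L[ℝ] E, HasFDerivAt L L' p₀ ∧
      ∀ v w, L' v w = D (v, 0) (0, w) :=
    ⟨_, hL1.clm_comp (hasFDerivAt_const inr p₀), fun v w => by simp [inl, inr]⟩
  obtain ⟨R', hR, hR'⟩ : ∃ R' : E →L[ℝ] E →L[ℝ] E, HasFDerivAt R R' p₀ ∧
      ∀ v w, R' v w = D (0, v) (w, 0) :=
    ⟨_, hR1.clm_comp (hasFDerivAt_const inl p₀), fun v w => by simp [inl, inr]⟩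
  have hL0 : L p₀ = 1 := by
    have h1 : HasFDerivAt (fun p => m (p₀, p)) (L p₀) p₀ :=
      HasFDerivAt.comp p₀ (f := fun p : E => (p₀, p)) hmd.hasFDerivAt hp2
    exact h1.unique ((hasFDerivAt_id p₀).congr_of_eventuallyEq hleft)
  have hR0 : R p₀ = 1 := by
    have h1 : HasFDerivAt (fun p => m (p, p₀)) (R p₀) p₀ :=
      HasFDerivAt.comp p₀ (f := fun p : E => (p, p₀)) hmd.hasFDerivAt hp1
    exact h1.unique ((hasFDerivAt_id p₀).congr_of_eventuallyEq hright)
  obtain ⟨G', hG, hG'⟩ : ∃ G' : E →L[ℝ] E →L[ℝ] E,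
      HasFDerivAt (fun p => Ring.inverse (L p)) G' p₀ ∧ ∀ v w, G' v w = -L' v w := by
    have hinv : HasFDerivAt Ring.inverse (-ContinuousLinearMap.id ℝ (E →L[ℝ] E)) (L p₀) := by
      rw [hL0]; exact hasFDerivAt_ringInverse_one
    exact ⟨_, hinv.comp p₀ hL, fun v w => by simp⟩
  have hunit : ∀ᶠ p in 𝓝 p₀, IsUnit (L p) :=
    hL.continuousAt.eventually (Units.isOpen.mem_nhds (by simp [hL0]))
  have hLx : ∀ u, HasFDerivAt (fun p => fderiv ℝ m (p, p₀) (0, u)) _ p₀ := fun u =>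
    hL1.clm_apply (hasFDerivAt_const ((0 : E), u) p₀)
  have hbr : ∀ u v, VectorField.lieBracket ℝ (fun p => fderiv ℝ m (p, p₀) (0, u))
      (fun p => fderiv ℝ m (p, p₀) (0, v)) p₀ = D (u, 0) (0, v) - D (v, 0) (0, u) := fun u v => by
    have h1 : ∀ u, fderiv ℝ m (p₀, p₀) (0, u) = u := fun u => by
      have := DFunLike.congr_fun hL0 u
      simpa [L, inr] using this
    rw [VectorField.lieBracket_eq]
    beta_reduce
    rw [(hLx u).fderiv, (hLx v).fderiv]
    simp [h1, inl]
  -- Here `L p` and `R p` are the differentials at the unit of left and right translation by `p`, so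
  -- `L⁻¹ R` is `Ad (p⁻¹)`. Its derivative in the direction `x` is `-ad x`, once the second
  -- derivative of `m` is known to be symmetric.
  have hSy : ∀ u, ∃ F : E →L[ℝ] E, HasFDerivAt (fun p => Ring.inverse (L p) (R p u)) F p₀ ∧
      F x = D (0, x) (u, 0) - D (x, 0) (0, u) := fun u => by
    refine ⟨_, hG.clm_apply (hR.clm_apply (hasFDerivAt_const u p₀)), ?_⟩
    have hR0u : R p₀ u = u := by rw [hR0]; rfl
    simp only [add_apply, ContinuousLinearMap.comp_apply,
      ContinuousLinearMap.flip_apply, zero_apply, map_zero, zero_add,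
      hG', hR', hL', hR0u]
    rw [hL0, Ring.inverse_one]
    exact (sub_eq_add_neg _ _).symm
  have hS0 : ∀ u, Ring.inverse (L p₀) (R p₀ u) = u := fun u => by
    rw [hL0, hR0, Ring.inverse_one]; rfl
  -- Invariance under `Ad (p⁻¹)` makes this function constant near `p₀`; the claim is that its
  -- derivative along `x` vanishes.
  have hconst : (fun p => B (Ring.inverse (L p) (R p y)) (Ring.inverse (L p) (R p z)))
      =ᶠ[𝓝 p₀] fun _ => B y z := by
    filter_upwards [hB, hunit] with p hp hu
    have h1 : ∀ u, L p (Ring.inverse (L p) (R p u)) = R p u := fun u => by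
      rw [← mul_apply_eq_comp, Ring.mul_inverse_cancel _ hu]; rfl
    exact hp _ _ _ _ (h1 y) (h1 z)
  obtain ⟨F, hF, hFx⟩ := hSy y
  obtain ⟨F', hF', hFx'⟩ := hSy z
  have hd := (B.hasFDerivAt_of_bilinear hF hF').unique
    ((hasFDerivAt_const (B y z) p₀).congr_of_eventuallyEq hconst)
  have hdx := DFunLike.congr_fun hd x
  simp only [add_apply, ContinuousLinearMap.precompR_apply, ContinuousLinearMap.compL_apply,
    ContinuousLinearMap.comp_apply,
    ContinuousLinearMap.precompL_apply, zero_apply, hS0, hFx, hFx',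
    map_sub, sub_apply] at hdx
  rw [hbr, hbr, hsymm (y, 0), hsymm (z, 0)]
  simp only [map_sub, sub_apply]
  linarith [hsymm (0, x) (y, 0)]

/-! ### The Lie group in the chart at the identity -/

namespace LieGroupMetric

open scoped Topology

variable {E : Type*} [NormedAddCommGroup E] [NormedSpace ℝ E]
  {G : Type*} [TopologicalSpace G] [ChartedSpace E G] [Group G]

variable (E G) in
/-- The multiplication of a Lie group in the chart at the identity. -/
noncomputable def chartMul (p : E × E) : E :=
  extChartAt 𝓘(ℝ, E) (1 : G)
    ((extChartAt 𝓘(ℝ, E) (1 : G)).symm p.1 * (extChartAt 𝓘(ℝ, E) (1 : G)).symm p.2)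

local notation "φ" => extChartAt 𝓘(ℝ, E) (1 : G)

theorem chart_symm_one : (φ).symm (φ 1) = 1 := extChartAt_to_inv (I := 𝓘(ℝ, E)) (1 : G)

theorem eventually_mem_target : ∀ᶠ p in 𝓝 (φ 1), p ∈ (φ).target :=
  extChartAt_target_mem_nhds (I := 𝓘(ℝ, E)) (1 : G)

theorem chartMul_one_left {p : E} (hp : p ∈ (φ).target) : chartMul E G (φ 1, p) = p := by
  simp only [chartMul, chart_symm_one, one_mul]
  exact (φ).right_inv hp

theorem chartMul_one_right {p : E} (hp : p ∈ (φ).target) : chartMul E G (p, φ 1) = p := by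
  simp only [chartMul, chart_symm_one, mul_one]
  exact (φ).right_inv hp

variable [LieGroup 𝓘(ℝ, E) ∞ G]

theorem contDiffAt_chartMul {p q : E} (hp : p ∈ (φ).target) (hq : q ∈ (φ).target)
    (hpq : (φ).symm p * (φ).symm q ∈ (φ).source) :
    ContDiffAt ℝ ∞ (chartMul E G) (p, q) := by
  rw [← contMDiffAt_iff_contDiffAt]
  have hs : ∀ p ∈ (φ).target, ContMDiffAt 𝓘(ℝ, E) 𝓘(ℝ, E) ∞ (φ).symm p := fun p hp =>
    (contMDiffOn_extChartAt_symm (1 : G)).contMDiffAt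
      ((isOpen_extChartAt_target (1 : G)).mem_nhds hp)
  rw [extChartAt_source] at hpq
  have h1 : ContMDiffAt (𝓘(ℝ, E).prod 𝓘(ℝ, E)) 𝓘(ℝ, E) ∞ (chartMul E G) (p, q) := by
    refine (contMDiffAt_extChartAt' hpq).comp (p, q) (ContMDiffAt.mul ?_ ?_)
    · exact (hs p hp).comp (p, q) contMDiffAt_fst
    · exact (hs q hq).comp (p, q) contMDiffAt_snd
  rw [modelWithCornersSelf_prod, ← chartedSpaceSelf_prod]
  exact h1

theorem contDiffAt_chartMul_one_right {p : E} (hp : p ∈ (φ).target) :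
    ContDiffAt ℝ ∞ (chartMul E G) (p, φ 1) :=
  contDiffAt_chartMul hp (mem_extChartAt_target 1) (by
    rw [chart_symm_one, mul_one]; exact (φ).map_target hp)

theorem contDiffAt_chartMul_one_left {p : E} (hp : p ∈ (φ).target) :
    ContDiffAt ℝ ∞ (chartMul E G) (φ 1, p) :=
  contDiffAt_chartMul (mem_extChartAt_target 1) hp (by
    rw [chart_symm_one, one_mul]; exact (φ).map_target hp)

theorem mdifferentiableAt_chart_symm_one :
    MDifferentiableAt 𝓘(ℝ, E) 𝓘(ℝ, E) (φ).symm (φ 1) :=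
  ((contMDiffOn_extChartAt_symm (n := ∞) (1 : G)).contMDiffAt
      (extChartAt_target_mem_nhds 1)).mdifferentiableAt (by simp)

theorem mfderiv_chart_symm_one_apply (v : E) :
    mfderiv 𝓘(ℝ, E) 𝓘(ℝ, E) (φ).symm (φ 1) v = v := by
  have h := mfderivWithin_range_extChartAt_symm (I := 𝓘(ℝ, E)) (x := (1 : G))
  rw [ModelWithCorners.range_eq_univ, mfderivWithin_univ] at h
  exact DFunLike.congr_fun h v

/-- A chart expression `φ ∘ T ∘ φ⁻¹`, with `T 1 = g`, has derivative `dφ ∘ dT` at `φ 1`. -/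
theorem fderiv_chart_comp {T : G → G} {g : G} (hT : MDifferentiableAt 𝓘(ℝ, E) 𝓘(ℝ, E) T 1)
    (hg : T 1 = g) (hgs : g ∈ (φ).source) (v : E) :
    fderiv ℝ (fun q => φ (T ((φ).symm q))) (φ 1) v =
      mfderiv 𝓘(ℝ, E) 𝓘(ℝ, E) φ g (mfderiv 𝓘(ℝ, E) 𝓘(ℝ, E) T 1 v : E) := by
  have hφ : MDifferentiableAt 𝓘(ℝ, E) 𝓘(ℝ, E) φ g :=
    mdifferentiableAt_extChartAt (by rwa [extChartAt_source] at hgs)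
  have h1 : MDifferentiableAt 𝓘(ℝ, E) 𝓘(ℝ, E) (T ∘ (φ).symm) (φ 1) :=
    MDifferentiableAt.comp_of_eq _ hT mdifferentiableAt_chart_symm_one chart_symm_one
  have h2 : (T ∘ (φ).symm) (φ 1) = g := by simp only [Function.comp_apply, chart_symm_one, hg]
  rw [← mfderiv_eq_fderiv]
  have h3 := mfderiv_comp_apply_of_eq _ hφ h1 h2 v
  have h4 := mfderiv_comp_apply_of_eq _ hT mdifferentiableAt_chart_symm_one chart_symm_one v
  refine Eq.trans h3 ?_
  have h5 : (mfderiv 𝓘(ℝ, E) 𝓘(ℝ, E) (T ∘ (φ).symm) (φ 1) v : E) =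
      (mfderiv 𝓘(ℝ, E) 𝓘(ℝ, E) T 1 v : E) :=
    Eq.trans h4 (congrArg (fun u : E => (mfderiv 𝓘(ℝ, E) 𝓘(ℝ, E) T 1 u : E))
      (mfderiv_chart_symm_one_apply v))
  exact congrArg (fun u : E => (mfderiv 𝓘(ℝ, E) 𝓘(ℝ, E) φ g u : E)) h5

theorem mdifferentiableAt_mul_left (g h : G) :
    MDifferentiableAt 𝓘(ℝ, E) 𝓘(ℝ, E) (fun y : G => g * y) h :=
  (contMDiff_mul_left (I := 𝓘(ℝ, E)) (n := ∞)).contMDiffAt.mdifferentiableAt (by simp)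

theorem mdifferentiableAt_mul_right (g h : G) :
    MDifferentiableAt 𝓘(ℝ, E) 𝓘(ℝ, E) (fun y : G => y * g) h :=
  (contMDiff_mul_right (I := 𝓘(ℝ, E)) (n := ∞)).contMDiffAt.mdifferentiableAt (by simp)

theorem fderiv_chartMul_left {p : E} (hp : p ∈ (φ).target) (v : E) :
    fderiv ℝ (chartMul E G) (p, φ 1) (0, v) =
      mfderiv 𝓘(ℝ, E) 𝓘(ℝ, E) φ ((φ).symm p)
        (mfderiv 𝓘(ℝ, E) 𝓘(ℝ, E) (fun y : G => (φ).symm p * y) 1 v : E) := by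
  rw [← fderiv_chart_comp (mdifferentiableAt_mul_left _ 1) (mul_one _) ((φ).map_target hp)]
  have h1 : HasFDerivAt (fun q : E => (p, q)) (ContinuousLinearMap.inr ℝ E E) (φ 1) :=
    hasFDerivAt_prodMk_right p (φ 1)
  have h2 := ((contDiffAt_chartMul_one_right hp).differentiableAt (by simp)).hasFDerivAt.comp
    (φ 1) (f := fun q : E => (p, q)) h1
  exact (DFunLike.congr_fun h2.fderiv v).symm

theorem fderiv_chartMul_right {p : E} (hp : p ∈ (φ).target) (v : E) :
    fderiv ℝ (chartMul E G) (φ 1, p) (v, 0) =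
      mfderiv 𝓘(ℝ, E) 𝓘(ℝ, E) φ ((φ).symm p)
        (mfderiv 𝓘(ℝ, E) 𝓘(ℝ, E) (fun y : G => y * (φ).symm p) 1 v : E) := by
  rw [← fderiv_chart_comp (mdifferentiableAt_mul_right _ 1) (one_mul _) ((φ).map_target hp)]
  have h1 : HasFDerivAt (fun q : E => (q, p)) (ContinuousLinearMap.inl ℝ E E) (φ 1) :=
    hasFDerivAt_prodMk_left (φ 1) p
  have h2 := ((contDiffAt_chartMul_one_left hp).differentiableAt (by simp)).hasFDerivAt.comp
    (φ 1) (f := fun q : E => (q, p)) h1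
  exact (DFunLike.congr_fun h2.fderiv v).symm

/-- The bracket of the Lie algebra of a Lie group in the chart at the identity. -/
theorem bracket_eq_lieBracket_chartMul (x y : GroupLieAlgebra 𝓘(ℝ, E) G) :
    @Eq E (⁅x, y⁆ : GroupLieAlgebra 𝓘(ℝ, E) G) <| VectorField.lieBracket ℝ
      (fun p => fderiv ℝ (chartMul E G) (p, φ 1) (0, (x : E)))
      (fun p => fderiv ℝ (chartMul E G) (p, φ 1) (0, (y : E))) (φ 1) := by
  -- In the chart, the left-invariant field of `x` is the partial derivative of the multiplication
  -- in its second variable.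
  have hpull : ∀ x : GroupLieAlgebra 𝓘(ℝ, E) G,
      (VectorField.mpullbackWithin 𝓘(ℝ, E) 𝓘(ℝ, E) (φ).symm (mulInvariantVectorField x)
        (Set.range 𝓘(ℝ, E)) : E → E) =ᶠ[𝓝 (φ 1)]
      fun p => fderiv ℝ (chartMul E G) (p, φ 1) (0, (x : E)) := fun x => by
    filter_upwards [eventually_mem_target (E := E) (G := G)] with p hp
    refine Eq.trans ?_ (fderiv_chartMul_left hp _).symm
    have hi := ContinuousLinearMap.inverse_eq
      (mfderivWithin_extChartAt_symm_comp_mfderiv_extChartAt (I := 𝓘(ℝ, E)) hp)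
      (mfderiv_extChartAt_comp_mfderivWithin_extChartAt_symm hp)
    exact DFunLike.congr_fun hi (mulInvariantVectorField x ((φ).symm p))
  have hid : ∀ u : E, ((mfderiv 𝓘(ℝ, E) 𝓘(ℝ, E) φ (1 : G)).inverse u : E) = u := fun u => by
    rw [mfderiv_extChartAt_self]
    exact DFunLike.congr_fun (ContinuousLinearMap.inverse_id (R := ℝ) (M := E)) u
  rw [GroupLieAlgebra.bracket_def, ← VectorField.mlieBracketWithin_univ,
    VectorField.mlieBracketWithin_apply]
  refine Eq.trans (hid _) ?_
  rw [Set.preimage_univ, Set.univ_inter]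
  have hr : Set.range 𝓘(ℝ, E) = Set.univ := ModelWithCorners.range_eq_univ _
  have huniv : ∀ (V W : E → E) (s : Set E), s = Set.univ → ∀ p,
      VectorField.lieBracketWithin ℝ V W s p = VectorField.lieBracket ℝ V W p := by
    rintro V W s rfl p
    rw [VectorField.lieBracketWithin_univ]
  exact (huniv _ _ _ hr _).trans ((hpull x).lieBracket_vectorField_eq (hpull y))

/-- The scalar product on the Lie algebra induced by a bi-invariant metric is `ad`-invariant. -/
theorem IsBiInvariant.inner_bracket [CompleteSpace E]
    {Q : ContMDiffRiemannianMetric 𝓘(ℝ, E) ∞ E (TangentSpace 𝓘(ℝ, E) : G → Type _)}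
    (hQ : IsBiInvariant Q) (x y z : GroupLieAlgebra 𝓘(ℝ, E) G) :
    Q.inner 1 ⁅x, y⁆ z = -Q.inner 1 y ⁅x, z⁆ := by
  let B : E →L[ℝ] E →L[ℝ] ℝ := Q.inner 1
  have hcongr : ∀ {a b : G}, a = b → ∀ v w : E, (Q.inner a : E →L[ℝ] E →L[ℝ] ℝ) v w =
      (Q.inner b : E →L[ℝ] E →L[ℝ] ℝ) v w := by
    rintro a _ rfl v w; rfl
  have h := lieBracket_skew_of_local_mul (chartMul E G) (φ 1)
    ((contDiffAt_chartMul_one_right (mem_extChartAt_target 1)).of_le (by norm_cast))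
    (eventually_mem_target.mono fun p hp => chartMul_one_left hp)
    (eventually_mem_target.mono fun p hp => chartMul_one_right hp) B (by
      filter_upwards [eventually_mem_target (E := E) (G := G)] with p hp v w y z hv hw
      set g : G := (φ).symm p
      have hinj : Function.Injective
          (mfderiv 𝓘(ℝ, E) 𝓘(ℝ, E) φ g : E → E) :=
        (isInvertible_mfderiv_extChartAt ((φ).map_target hp)).injective
      rw [fderiv_chartMul_left hp, fderiv_chartMul_right hp] at hv hw
      -- Left and right translation by `g` both carry the identity to `g` and preserve `Q`, so
      -- vectors at the identity with equal images there have equal products.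
      have h1 := hQ.1 g 1 v w
      have h2 := hQ.2 g 1 y z
      refine h1.symm.trans (Eq.trans ?_ h2)
      refine Eq.trans ?_ (hcongr (by rw [mul_one, one_mul] : g * 1 = 1 * g) _ _)
      exact congrArg₂ (fun a b : E => (Q.inner (g * 1) : E →L[ℝ] E →L[ℝ] ℝ) a b)
        (hinj hv) (hinj hw)) x y z
  rw [← bracket_eq_lieBracket_chartMul, ← bracket_eq_lieBracket_chartMul] at h
  exact h

end LieGroupMetric

/-! ### Transfer to a Euclidean space and conclusion -/

open scoped RealInnerProductSpace in
/-- A finite-dimensional real vector space with a scalar product is isometric to a Euclidean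
space. -/
theorem InnerProductSpace.Core.exists_linearEquiv_euclideanSpace {V : Type*} [AddCommGroup V]
    [Module ℝ V] [FiniteDimensional ℝ V] (c : InnerProductSpace.Core ℝ V) :
    ∃ f : V ≃ₗ[ℝ] EuclideanSpace ℝ (Fin (finrank ℝ V)), ∀ v w, ⟪f v, f w⟫ = c.inner v w := by
  let _ : NormedAddCommGroup V := c.toNormedAddCommGroup
  let _ : InnerProductSpace ℝ V := InnerProductSpace.ofCore c.toCore
  exact ⟨(stdOrthonormalBasis ℝ V).repr.toLinearEquiv, fun v w =>
    (stdOrthonormalBasis ℝ V).repr.inner_map_map v w⟩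

open scoped RealInnerProductSpace

theorem mainTheorem7
    {E : Type*} [NormedAddCommGroup E] [NormedSpace ℝ E] [FiniteDimensional ℝ E]
    {G : Type*} [TopologicalSpace G] [ChartedSpace E G] [Group G] [LieGroup 𝓘(ℝ, E) ∞ G]
    [CompactSpace G] [ConnectedSpace G]
    (Q : ContMDiffRiemannianMetric 𝓘(ℝ, E) ∞ E (TangentSpace 𝓘(ℝ, E) : G → Type _))
    (hQ : LieGroupMetric.IsBiInvariant Q) :
    ∃ C : ℝ, 0 < C ∧
      ∀ (hn : 0 < finrank ℝ (GroupLieAlgebra 𝓘(ℝ, E) G))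
        (I : Finset (Fin (finrank ℝ (GroupLieAlgebra 𝓘(ℝ, E) G)))), ⟨0, hn⟩ ∈ I →
        ∃ U : Set (LieGroupMetric.orthonormalBases Q),
          IsOpen U ∧ LieGroupMetric.abelianBases Q I ⊆ U ∧
          ∀ b ∈ U,
            ∑ j ∈ I, ∑ k ∈ I, LieGroupMetric.structureConstSq Q b.1 ⟨0, hn⟩ j k ≤
              C * ∑ j ∈ I, ∑ k ∈ Iᶜ, LieGroupMetric.structureConstSq Q b.1 ⟨0, hn⟩ j k := by
  have : CompleteSpace E := FiniteDimensional.complete ℝ E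
  have : FiniteDimensional ℝ (GroupLieAlgebra 𝓘(ℝ, E) G) := inferInstanceAs (FiniteDimensional ℝ E)
  -- The norm that `𝔤` inherits from `E` is unrelated to `Q`, so the bracket is moved to a space
  -- whose own inner product is `Q`.
  obtain ⟨f, hf⟩ := (Q.toRiemannianMetric.toCore 1).exists_linearEquiv_euclideanSpace
  have hf' : ∀ v w : GroupLieAlgebra 𝓘(ℝ, E) G, ⟪f v, f w⟫ = Q.inner 1 v w := hf
  let β : EuclideanSpace ℝ (Fin (finrank ℝ (GroupLieAlgebra 𝓘(ℝ, E) G))) →ₗ[ℝ]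
      EuclideanSpace ℝ (Fin (finrank ℝ (GroupLieAlgebra 𝓘(ℝ, E) G))) →ₗ[ℝ]
      EuclideanSpace ℝ (Fin (finrank ℝ (GroupLieAlgebra 𝓘(ℝ, E) G))) :=
    LinearMap.mk₂ ℝ (fun u v => f ⁅f.symm u, f.symm v⁆)
      (fun _ _ _ => by simp only [map_add, add_lie]) (fun _ _ _ => by simp only [map_smul, smul_lie])
      (fun _ _ _ => by simp only [map_add, lie_add]) (fun _ _ _ => by simp only [map_smul, lie_smul])
  have hβ : ∀ u v, β u v = f ⁅f.symm u, f.symm v⁆ := fun _ _ => rfl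
  have hβf : ∀ x y, β (f x) (f y) = f ⁅x, y⁆ := fun x y => by
    rw [hβ, f.symm_apply_apply, f.symm_apply_apply]
  obtain ⟨C, δ, hC, hδ, key⟩ := ConjBracket.exists_tangential_le_normal
    (ι := Fin (finrank ℝ (GroupLieAlgebra 𝓘(ℝ, E) G))) β
    (fun x y => by rw [hβ, hβ, ← lie_skew, map_neg])
    (fun x y z => by
      simp only [hβ, f.symm_apply_apply]
      rw [leibniz_lie, map_add])
    (fun x y z => by
      obtain ⟨x, rfl⟩ := f.surjective x
      obtain ⟨y, rfl⟩ := f.surjective y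
      obtain ⟨z, rfl⟩ := f.surjective z
      rw [hβf, hβf, hf', hf', hQ.inner_bracket])
  refine ⟨C, hC, fun hn I _ =>
    -- The strict inequality makes this set open, and on abelian bases all these brackets vanish.
    ⟨{b | ∀ i ∈ I, ∀ j ∈ I, ‖β (f (b.1 i)) (f (b.1 j))‖ < δ}, ?_, ?_, ?_⟩⟩
  · have : T2Space (GroupLieAlgebra 𝓘(ℝ, E) G) := inferInstanceAs (T2Space E)
    have hfc : Continuous f := LinearMap.continuous_of_finiteDimensional f.toLinearMap
    have hb : ∀ i, Continuous fun b : LieGroupMetric.orthonormalBases Q => f (b.1 i) := fun i =>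
      hfc.comp ((continuous_apply i).comp continuous_subtype_val)
    simp only [Set.ofPred_forall]
    refine isOpen_biInter_finset fun i _ => isOpen_biInter_finset fun j _ =>
      isOpen_lt ?_ continuous_const
    exact ((ConjBracket.continuous_uncurry β).comp ((hb i).prodMk (hb j))).norm
  · rintro b ⟨𝔱, h𝔱, hab⟩ i hi j hj
    have hmem : ∀ i ∈ I, b.1 i ∈ 𝔱 := fun i hi => by
      rw [← LieSubalgebra.mem_toSubmodule, h𝔱]
      exact Submodule.subset_span ⟨i, hi, rfl⟩
    have h0 : (⁅(⟨b.1 i, hmem i hi⟩ : 𝔱), (⟨b.1 j, hmem j hj⟩ : 𝔱)⁆ : 𝔱) = 0 := hab.trivial _ _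
    have h1 : ⁅b.1 i, b.1 j⁆ = 0 := congrArg Subtype.val h0
    rw [hβf, h1, map_zero, norm_zero]
    exact hδ
  · rintro ⟨b, ⟨Bs, rfl⟩, hon⟩ hb
    let e : OrthonormalBasis (Fin (finrank ℝ (GroupLieAlgebra 𝓘(ℝ, E) G))) ℝ
        (EuclideanSpace ℝ (Fin (finrank ℝ (GroupLieAlgebra 𝓘(ℝ, E) G)))) :=
      (Bs.map f).toOrthonormalBasis (orthonormal_iff_ite.2 fun i j => by
        rw [Basis.map_apply, Basis.map_apply, hf', hon])
    have he : ∀ i, e i = f (Bs i) := fun i => by simp [e]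
    have h := key e I (e ⟨0, hn⟩) fun i hi j hj => by
      rw [he, he]; exact (hb i hi j hj).le
    simp only [he, hβf, hf'] at h
    exact h
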